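/- Let $\Gamma=(V,E)$ be a simple (undirected, loopless, possibly infinite) graph and let $\{M_\alpha:\alpha\in V\}$ be a family of mutually disjoint monoids, with $1_\alpha$ the identity of $M_\alpha$. The graph product $\mathscr{GP}(\Gamma,\mathcal M)$ is the monoid given by the presentation $\langle X\mid R\rangle$, where $X=\bigcup_{\alpha\in V}M_\alpha$ and, writing $\circ$ for concatenation of words and $\epsilon$ for the empty word, $R$ consists of the relations $1_\alpha=\epsilon$ ($\alpha\in V$), $x\circ y=xy$ ($x,y\in M_\alpha$, $\alpha\in V$), and $x\circ y=y\circ x$ ($x\in M_\alpha$, $y\in M_\beta$, $(\alpha,\beta)\in E$). A left congruence on a monoid $M$ is an equivalence relation $\rho$ on $M$ such that $(x,y)\in\rho$ implies $(cx,cy)\in\rho$ for all $c\in M$; it is finitely generated if it is the smallest left congruence containing some finite subset of $M\times M$. A monoid $M$ is finitely left equated if for every $a\in M$ the left congruence $\mathbf l(a)=\{(s,t)\in M\times M: sa=ta\}$ is finitely generated. **Theorem.** The graph product $\mathscr{GP}(\Gamma,\mathcal M)$ is finitely left equated if and only if every vertex monoid $M_\alpha$, $\alpha\in V$, is finitely left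 equated. -/

import Mathlib

/-- A left congruence on a monoid `M`: an equivalence relation on `M` which is closed under
multiplication on the left by elements of `M`. -/
@[ext]
structure LeftCongruence (M : Type*) [Monoid M] extends Setoid M where
  mul_left' : ∀ (c : M) {x y : M}, r x y → r (c * x) (c * y)

namespace LeftCongruence

variable {M : Type*} [Monoid M]

/-- The relation underlying the left congruence generated by a set `X` of pairs. -/
inductive GenRel (X : Set (M × M)) : M → M → Prop
  | of (x y : M) : (x, y) ∈ X → GenRel X x y
  | refl (x : M) : GenRel X x x
  | symm {x y : M} : GenRel X x y → GenRel X y x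
  | trans {x y z : M} : GenRel X x y → GenRel X y z → GenRel X x z
  | mul_left (c : M) {x y : M} : GenRel X x y → GenRel X (c * x) (c * y)

/-- The smallest left congruence on `M` containing a set `X` of pairs
(see `LeftCongruence.subset_gen` and `LeftCongruence.gen_le`). -/
def gen (X : Set (M × M)) : LeftCongruence M where
  r := GenRel X
  iseqv := ⟨GenRel.refl, GenRel.symm, GenRel.trans⟩
  mul_left' := fun c _ _ h => GenRel.mul_left c h

theorem subset_gen (X : Set (M × M)) {x y : M} (h : (x, y) ∈ X) : (gen X).r x y :=
  GenRel.of x y h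

theorem gen_le (X : Set (M × M)) (ρ : LeftCongruence M)
    (hX : ∀ x y : M, (x, y) ∈ X → ρ.r x y) {x y : M} (h : (gen X).r x y) : ρ.r x y := by
  have h' : GenRel X x y := h
  induction h' with
  | of x y hxy => exact hX x y hxy
  | refl x => exact ρ.iseqv.refl x
  | symm h1 ih => exact ρ.iseqv.symm (ih h1)
  | trans h1 h2 ih1 ih2 => exact ρ.iseqv.trans (ih1 h1) (ih2 h2)
  | mul_left c h1 ih => exact ρ.mul_left' c (ih h1)

/-- A left congruence is finitely generated if it is the smallest left congruence containing some
finite set of pairs. -/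
def IsFinitelyGenerated (ρ : LeftCongruence M) : Prop :=
  ∃ X : Set (M × M), X.Finite ∧ gen X = ρ

/-- The left annihilator congruence of `a`, consisting of the pairs `(s, t)` with
`s * a = t * a`. -/
def leftAnnihilator (a : M) : LeftCongruence M where
  r := fun s t => s * a = t * a
  iseqv := ⟨fun _ => rfl, fun h => h.symm, fun h1 h2 => h1.trans h2⟩
  mul_left' := fun c x y h => by rw [mul_assoc, mul_assoc, h]

end LeftCongruence

/-- A monoid is finitely left equated if the left annihilator congruence of each of its elements
is finitely generated as a left congruence. -/
def FinitelyLeftEquated (M : Type*) [Monoid M] : Prop :=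
  ∀ a : M, (LeftCongruence.leftAnnihilator a).IsFinitelyGenerated

/-- The defining relations of the graph product, on words in the disjoint union of the vertex
monoids. -/
inductive GraphProduct.Rel {V : Type*} (Γ : SimpleGraph V) (M : V → Type*)
    [∀ α, Monoid (M α)] : FreeMonoid (Σ α, M α) → FreeMonoid (Σ α, M α) → Prop
  | one (α : V) : GraphProduct.Rel Γ M (FreeMonoid.of ⟨α, 1⟩) 1
  | mul {α : V} (x y : M α) :
      GraphProduct.Rel Γ M (FreeMonoid.of ⟨α, x⟩ * FreeMonoid.of ⟨α, y⟩) (FreeMonoid.of ⟨α, x * y⟩)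
  | comm {α β : V} (h : Γ.Adj α β) (x : M α) (y : M β) :
      GraphProduct.Rel Γ M (FreeMonoid.of ⟨α, x⟩ * FreeMonoid.of ⟨β, y⟩)
        (FreeMonoid.of ⟨β, y⟩ * FreeMonoid.of ⟨α, x⟩)

/-- The graph product of the monoids `M α` with respect to the simple graph `Γ`: the quotient of
the free monoid on the disjoint union of the `M α` by the congruence generated by the defining
relations. -/
def GraphProduct {V : Type*} (Γ : SimpleGraph V) (M : V → Type*) [∀ α, Monoid (M α)] : Type _ :=
  (conGen (GraphProduct.Rel Γ M)).Quotient

instance GraphProduct.instMonoid {V : Type*} (Γ : SimpleGraph V) (M : V → Type*)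
    [∀ α, Monoid (M α)] : Monoid (GraphProduct Γ M) :=
  inferInstanceAs (Monoid (conGen (GraphProduct.Rel Γ M)).Quotient)

/-!
Let `G` be the graph product. The forward direction holds because every vertex monoid is a retract
of `G` (`GraphProduct.proj`), and being finitely left equated passes to retracts.

For the converse the point is to understand right multiplication in `G`. A van der Waerden argument
(`GraphProduct.normalForm`), in which the letters act from the right on reduced words modulo
shuffling, shows that every `g` can be written as `g = rem γ g * fin γ g`, where `fin γ g` in `M γ`
is the syllable of `g` from the vertex `γ` that can be moved to the end. These maps have simple
rules for multiplication by one letter: multiplication by `m` in `M γ` changes `fin γ` to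
`fin γ g * m` and keeps `rem γ`; multiplication by a letter from a vertex adjacent to `γ` keeps
`fin γ` and multiplies `rem γ`; multiplication by a letter from any other vertex makes `fin γ`
trivial unless that letter is absorbed completely. Nothing else about normal forms is used below.

The annihilator congruence of the element spelled by a word `w` is treated by strong induction on
the length of `w`. If `w` spells `c * b`, where `c` is a left invertible letter and `b` is
spelled by a shorter word, then finite generation for `c` and for `b` gives it for `c * b`
(`LeftCongruence.isFinitelyGenerated_mul`). If no such rewriting is possible, then `w` is `Rigid`:
the letters of `w` that can be moved to its front are not left invertible. Left multiplication of
`w` by `s` then replaces each such letter `c` by some `m * c ≠ 1` and leaves the other letters of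
`w` unchanged, and the annihilator of `w` is generated by the annihilators of these initial letters
in their vertex monoids (`GraphProduct.Rigid.exists_generators`).
-/

/-! ### Finitely generated left congruences -/

namespace LeftCongruence

variable {M N : Type*} [Monoid M] [Monoid N]

theorem GenRel.map (f : M →* N) {X : Set (M × M)} {Y : Set (N × N)}
    (hXY : ∀ x y, (x, y) ∈ X → (f x, f y) ∈ Y) {s t : M} (h : GenRel X s t) :
    GenRel Y (f s) (f t) := by
  induction h with
  | of x y h => exact .of _ _ (hXY x y h)
  | refl x => exact .refl _
  | symm _ ih => exact .symm ih
  | trans _ _ ih₁ ih₂ => exact .trans ih₁ ih₂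
  | mul_left c _ ih => simpa only [map_mul] using GenRel.mul_left (f c) ih

theorem GenRel.mono {X Y : Set (M × M)} (hXY : X ⊆ Y) {s t : M} (h : GenRel X s t) :
    GenRel Y s t :=
  h.map (MonoidHom.id M) fun _ _ hx => hXY hx

/-- Although `GenRel X` is only a left congruence, it is compatible with right multiplication by
elements commuting with the generating pairs. -/
theorem GenRel.mul_right_of_commute {X : Set (M × M)} {m : M}
    (hX : ∀ p ∈ X, Commute m p.1 ∧ Commute m p.2) {s t : M} (h : GenRel X s t) :
    GenRel X (s * m) (t * m) := by
  induction h with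
  | of x y h =>
    rw [← (hX _ h).1.eq, ← (hX _ h).2.eq]
    exact .mul_left m (.of x y h)
  | refl x => exact .refl _
  | symm _ ih => exact .symm ih
  | trans _ _ ih₁ ih₂ => exact .trans ih₁ ih₂
  | mul_left c _ ih => simpa only [mul_assoc] using GenRel.mul_left c ih

theorem isFinitelyGenerated_leftAnnihilator_iff {a : M} :
    (leftAnnihilator a).IsFinitelyGenerated ↔
      ∃ X : Set (M × M), X.Finite ∧ (∀ p ∈ X, p.1 * a = p.2 * a) ∧
        ∀ s t, s * a = t * a → GenRel X s t := by
  constructor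
  · rintro ⟨X, hX, h⟩
    have key : ∀ s t, GenRel X s t ↔ s * a = t * a := fun s t =>
      iff_of_eq (congrArg (fun ρ : LeftCongruence M => ρ.r s t) h)
    exact ⟨X, hX, fun p hp => (key _ _).1 (.of _ _ hp), fun s t => (key s t).2⟩
  · rintro ⟨X, hX, h₁, h₂⟩
    refine ⟨X, hX, LeftCongruence.ext ?_⟩
    funext s t
    exact propext ⟨gen_le X (leftAnnihilator a) fun x y hxy => h₁ _ hxy, h₂ s t⟩

/-- If `c` has a left inverse `u`, then a derivation of `(s * c, t * c)` from generators `(x, y)` of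
the annihilator of `b` can be pulled back along right multiplication by `c` to a derivation of
`(s, t)` which uses the pairs `(x * u, y * u)` and the annihilator of `c`. -/
theorem isFinitelyGenerated_mul {u c b : M} (huc : u * c = 1)
    (hc : (leftAnnihilator c).IsFinitelyGenerated) (hb : (leftAnnihilator b).IsFinitelyGenerated) :
    (leftAnnihilator (c * b)).IsFinitelyGenerated := by
  rw [isFinitelyGenerated_leftAnnihilator_iff] at *
  obtain ⟨X, hX, hX₁, hX₂⟩ := hc
  obtain ⟨Y, hY, hY₁, hY₂⟩ := hb
  refine ⟨X ∪ (fun p => (p.1 * u, p.2 * u)) '' Y, hX.union (hY.image _), ?_, fun s t h => ?_⟩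
  · rintro p (hp | ⟨q, hq, rfl⟩)
    · rw [← mul_assoc, hX₁ p hp, mul_assoc]
    · have hr : ∀ x : M, x * u * (c * b) = x * b := fun x => by
        rw [mul_assoc, ← mul_assoc u, huc, one_mul]
      simpa only [hr] using hY₁ q hq
  · have hcu : ∀ x : M, GenRel (X ∪ (fun p => (p.1 * u, p.2 * u)) '' Y) x (x * c * u) := fun x =>
      (hX₂ _ _ (by rw [mul_assoc (x * c), huc, mul_one])).mono Set.subset_union_left
    have key : ∀ x y, GenRel Y x y →
        GenRel (X ∪ (fun p => (p.1 * u, p.2 * u)) '' Y) (x * u) (y * u) := by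
      intro x y hxy
      induction hxy with
      | of x y h => exact .of _ _ (.inr ⟨(x, y), h, rfl⟩)
      | refl x => exact .refl _
      | symm _ ih => exact .symm ih
      | trans _ _ ih₁ ih₂ => exact .trans ih₁ ih₂
      | mul_left c _ ih => simpa only [mul_assoc] using GenRel.mul_left c ih
    have h' := key (s * c) (t * c) (hY₂ _ _ (by simpa only [mul_assoc] using h))
    exact ((hcu s).trans h').trans (hcu t).symm

end LeftCongruence

theorem FinitelyLeftEquated.of_retract {M N : Type*} [Monoid M] [Monoid N] (f : M →* N)
    (g : N →* M) (hgf : ∀ x, g (f x) = x) (hN : FinitelyLeftEquated N) :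
    FinitelyLeftEquated M := by
  intro a
  obtain ⟨X, hX, hX₁, hX₂⟩ := LeftCongruence.isFinitelyGenerated_leftAnnihilator_iff.1 (hN (f a))
  refine LeftCongruence.isFinitelyGenerated_leftAnnihilator_iff.2
    ⟨Prod.map g g '' X, hX.image _, ?_, fun s t h => ?_⟩
  · rintro _ ⟨q, hq, rfl⟩
    simpa only [Prod.map_fst, Prod.map_snd, map_mul, hgf] using congrArg g (hX₁ q hq)
  · have := (hX₂ (f s) (f t) (by rw [← map_mul, ← map_mul, h])).map g
      (Y := Prod.map g g '' X) fun x y hxy => ⟨(x, y), hxy, rfl⟩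
    rwa [hgf, hgf] at this

/-! ### The graph product and its universal property -/

namespace GraphProduct

variable {V : Type*} {Γ : SimpleGraph V} {M : V → Type*} [∀ α, Monoid (M α)]

/-- The class of a word in the graph product. -/
def mk (Γ : SimpleGraph V) (M : V → Type*) [∀ α, Monoid (M α)] :
    FreeMonoid (Σ α, M α) →* GraphProduct Γ M :=
  (conGen (Rel Γ M)).mk'

theorem mk_eq_of_rel {u v : FreeMonoid (Σ α, M α)} (h : Rel Γ M u v) : mk Γ M u = mk Γ M v :=
  (Con.eq _).2 (ConGen.Rel.of _ _ h)

/-- The canonical map from a vertex monoid to the graph product. -/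
def of (Γ : SimpleGraph V) {M : V → Type*} [∀ α, Monoid (M α)] (α : V) :
    M α →* GraphProduct Γ M where
  toFun x := mk Γ M (FreeMonoid.of ⟨α, x⟩)
  map_one' := (mk_eq_of_rel (.one α)).trans (map_one _)
  map_mul' x y := by rw [← map_mul, mk_eq_of_rel (.mul x y)]

theorem commute_of {α β : V} (h : Γ.Adj α β) (x : M α) (y : M β) :
    Commute (of Γ α x) (of Γ β y) := by
  change mk Γ M _ * mk Γ M _ = mk Γ M _ * mk Γ M _
  rw [← map_mul, ← map_mul, mk_eq_of_rel (.comm h x y)]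

/-- The homomorphism out of the graph product determined by homomorphisms on the vertex monoids
whose images commute for adjacent vertices. -/
def lift {N : Type*} [Monoid N] (f : ∀ α, M α →* N)
    (hf : ∀ α β, Γ.Adj α β → ∀ x y, f α x * f β y = f β y * f α x) : GraphProduct Γ M →* N :=
  Con.lift (conGen (Rel Γ M)) (FreeMonoid.lift fun a => f a.1 a.2) <| Con.conGen_le.2 <| by
    intro u v h
    rw [Con.ker_rel]
    cases h with
    | one α => simp
    | mul x y => simp
    | comm h x y => simpa using hf _ _ h x y

@[simp]
theorem lift_of {N : Type*} [Monoid N] (f : ∀ α, M α →* N)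
    (hf : ∀ α β, Γ.Adj α β → ∀ x y, f α x * f β y = f β y * f α x) (α : V) (x : M α) :
    lift f hf (of Γ α x) = f α x := by
  change FreeMonoid.lift (fun a : Σ α, M α => f a.1 a.2) (FreeMonoid.of ⟨α, x⟩) = _
  simp

open Classical in
/-- The retraction of the graph product onto a vertex monoid, killing the other vertices. -/
noncomputable def proj (Γ : SimpleGraph V) (M : V → Type*) [∀ α, Monoid (M α)] (α : V) :
    GraphProduct Γ M →* M α :=
  lift (fun β => if h : β = α then h ▸ MonoidHom.id (M β) else 1) <| by
    intro β γ h x y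
    by_cases hβ : β = α
    · have hγ : γ ≠ α := fun e => h.ne (hβ.trans e.symm)
      simp [hγ]
    · simp [hβ]

theorem proj_of (α : V) (x : M α) : proj Γ M α (of Γ α x) = x := by
  simp [proj]

/-! ### Words and extraction of a final syllable -/

/-- The element spelled by a word. Words are written backwards: the head is the last letter, so
that right multiplication in the graph product corresponds to `List.cons`. -/
def eval (Γ : SimpleGraph V) {M : V → Type*} [∀ α, Monoid (M α)] :
    List (Σ α, M α) → GraphProduct Γ M
  | [] => 1
  | a :: l => eval Γ l * of Γ a.1 a.2

theorem eval_append (l l' : List (Σ α, M α)) : eval Γ (l ++ l') = eval Γ l' * eval Γ l := by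
  induction l with
  | nil => exact (mul_one _).symm
  | cons a l ih => rw [List.cons_append, eval, eval, ih, mul_assoc]

theorem exists_eval_eq (g : GraphProduct Γ M) : ∃ l, eval Γ l = g := by
  obtain ⟨w, rfl⟩ := Con.mk'_surjective (c := conGen (Rel Γ M)) g
  change ∃ l, eval Γ l = mk Γ M w
  induction w using FreeMonoid.inductionOn' with
  | one => exact ⟨[], (map_one _).symm⟩
  | of_mul a w ih =>
    obtain ⟨l, hl⟩ := ih
    refine ⟨l ++ [a], ?_⟩
    rw [eval_append, hl, map_mul]
    exact congrArg (· * mk Γ M w) (one_mul _)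

theorem commute_of_eval {γ : V} {w : List (Σ α, M α)} (h : ∀ a ∈ w, Γ.Adj γ a.1) (m : M γ) :
    Commute (of Γ γ m) (eval Γ w) := by
  induction w with
  | nil => exact Commute.one_right _
  | cons a w ih =>
    rw [List.forall_mem_cons] at h
    exact (ih h.2).mul_right (commute_of h.1 m a.2)

/-- Two words are related if one arises from the other by repeatedly exchanging neighbouring letters
from adjacent vertices. -/
inductive Shuffle (Γ : SimpleGraph V) {M : V → Type*} :
    List (Σ α, M α) → List (Σ α, M α) → Prop
  | refl (l : List (Σ α, M α)) : Shuffle Γ l l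
  | swap (a b : Σ α, M α) (l : List (Σ α, M α)) (h : Γ.Adj a.1 b.1) :
      Shuffle Γ (a :: b :: l) (b :: a :: l)
  | cons (a : Σ α, M α) {l l' : List (Σ α, M α)} : Shuffle Γ l l' → Shuffle Γ (a :: l) (a :: l')
  | trans {l₁ l₂ l₃ : List (Σ α, M α)} : Shuffle Γ l₁ l₂ → Shuffle Γ l₂ l₃ → Shuffle Γ l₁ l₃

theorem Shuffle.symm {M : V → Type*} {l l' : List (Σ α, M α)} (h : Shuffle Γ l l') :
    Shuffle Γ l' l := by
  induction h with
  | refl l => exact .refl l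
  | swap a b l h => exact .swap b a l h.symm
  | cons a _ ih => exact .cons a ih
  | trans _ _ ih₁ ih₂ => exact .trans ih₂ ih₁

theorem Shuffle.eval_eq {l l' : List (Σ α, M α)} (h : Shuffle Γ l l') :
    eval Γ l = eval Γ l' := by
  induction h with
  | refl l => rfl
  | swap a b l h => simp only [eval, mul_assoc, (commute_of h a.2 b.2).eq]
  | cons a _ ih => simp only [eval, ih]
  | trans _ _ ih₁ ih₂ => exact ih₁.trans ih₂

open Classical in
/-- `extract Γ α l` moves a letter from the vertex `α` to the end of the word spelled by `l` (that
is, to the head of `l`), if there is one from which only letters from vertices adjacent to `α`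
separate it. The result consists of this letter and the rest of the word; if there is no such
letter, it consists of `1` and `l`. -/
noncomputable def extract (Γ : SimpleGraph V) {M : V → Type*} [∀ α, Monoid (M α)] (α : V) :
    List (Σ α, M α) → M α × List (Σ α, M α)
  | [] => (1, [])
  | a :: l =>
    if h : a.1 = α then (h ▸ a.2, l)
    else if Γ.Adj α a.1 then ((extract Γ α l).1, a :: (extract Γ α l).2)
    else (1, a :: l)

@[simp]
theorem extract_cons_self (α : V) (x : M α) (l : List (Σ α, M α)) :
    extract Γ α (⟨α, x⟩ :: l) = (x, l) := by
  simp [extract]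

theorem extract_cons_of_adj {α : V} {a : Σ α, M α} (h : Γ.Adj α a.1) (l : List (Σ α, M α)) :
    extract Γ α (a :: l) = ((extract Γ α l).1, a :: (extract Γ α l).2) := by
  rw [extract, dif_neg h.ne', if_pos h]

theorem extract_cons_of_not_adj {α : V} {a : Σ α, M α} (hne : a.1 ≠ α) (h : ¬ Γ.Adj α a.1)
    (l : List (Σ α, M α)) : extract Γ α (a :: l) = (1, a :: l) := by
  rw [extract, dif_neg hne, if_neg h]

/-- A case distinction for the position of a letter `a` relative to a vertex `α`. -/
theorem letter_cases {M : V → Type*} (Γ : SimpleGraph V) (α : V) (a : Σ α, M α) :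
    (∃ x : M α, a = ⟨α, x⟩) ∨ Γ.Adj α a.1 ∨ (a.1 ≠ α ∧ ¬ Γ.Adj α a.1) := by
  obtain ⟨β, x⟩ := a
  by_cases h : β = α
  · subst h
    exact .inl ⟨x, rfl⟩
  · by_cases h' : Γ.Adj α β
    · exact .inr (.inl h')
    · exact .inr (.inr ⟨h, h'⟩)

theorem eval_extract (α : V) (l : List (Σ α, M α)) :
    eval Γ (extract Γ α l).2 * of Γ α (extract Γ α l).1 = eval Γ l := by
  induction l with
  | nil => simp [extract, eval]
  | cons a l ih =>
    obtain ⟨x, rfl⟩ | h | ⟨hne, h⟩ := letter_cases Γ α a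
    · simp [eval]
    · rw [extract_cons_of_adj h, eval, eval, ← ih, mul_assoc, mul_assoc,
        (commute_of h (extract Γ α l).1 a.2).eq]
    · simp [extract_cons_of_not_adj hne h]

theorem Shuffle.extract {l l' : List (Σ α, M α)} (α : V) (h : Shuffle Γ l l') :
    (extract Γ α l).1 = (GraphProduct.extract Γ α l').1 ∧
      Shuffle Γ (GraphProduct.extract Γ α l).2 (GraphProduct.extract Γ α l').2 := by
  induction h with
  | refl l => exact ⟨rfl, .refl _⟩
  | swap a b l h =>
    obtain ⟨x, rfl⟩ | ha | ⟨hane, ha⟩ := letter_cases Γ α a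
    · rw [extract_cons_self, extract_cons_of_adj (a := b) h, extract_cons_self]
      exact ⟨rfl, .refl _⟩
    · obtain ⟨y, rfl⟩ | hb | ⟨hbne, hb⟩ := letter_cases Γ α b
      · rw [extract_cons_self, extract_cons_of_adj ha, extract_cons_self]
        exact ⟨rfl, .refl _⟩
      · simp only [extract_cons_of_adj ha, extract_cons_of_adj hb]
        exact ⟨trivial, .swap _ _ _ h⟩
      · simp only [extract_cons_of_adj ha, extract_cons_of_not_adj hbne hb]
        exact ⟨trivial, .swap _ _ _ h⟩
    · obtain ⟨y, rfl⟩ | hb | ⟨hbne, hb⟩ := letter_cases Γ α b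
      · exact absurd h.symm ha
      · simp only [extract_cons_of_adj hb, extract_cons_of_not_adj hane ha]
        exact ⟨trivial, .swap _ _ _ h⟩
      · simp only [extract_cons_of_not_adj hbne hb, extract_cons_of_not_adj hane ha]
        exact ⟨trivial, .swap _ _ _ h⟩
  | cons a h ih =>
    obtain ⟨x, rfl⟩ | ha | ⟨hane, ha⟩ := letter_cases Γ α a
    · simpa using h
    · simp only [extract_cons_of_adj ha]
      exact ⟨ih.1, .cons _ ih.2⟩
    · simp only [extract_cons_of_not_adj hane ha]
      exact ⟨trivial, .cons _ h⟩
  | trans _ _ ih₁ ih₂ => exact ⟨ih₁.1.trans ih₂.1, ih₁.2.trans ih₂.2⟩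

theorem extract_extract {α β : V} (h : Γ.Adj α β) (l : List (Σ α, M α)) :
    (extract Γ β (extract Γ α l).2).1 = (extract Γ β l).1 ∧
      (extract Γ β (extract Γ α l).2).2 = (extract Γ α (extract Γ β l).2).2 := by
  induction l with
  | nil => exact ⟨rfl, rfl⟩
  | cons a l ih =>
    obtain ⟨x, rfl⟩ | ha | ⟨hane, ha⟩ := letter_cases Γ α a
    · rw [extract_cons_self, extract_cons_of_adj (a := ⟨α, x⟩) h.symm, extract_cons_self]
      exact ⟨rfl, rfl⟩
    · obtain ⟨y, rfl⟩ | hb | ⟨hbne, hb⟩ := letter_cases Γ β a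
      · simp only [extract_cons_of_adj ha, extract_cons_self, true_and]
      · simp only [extract_cons_of_adj ha, extract_cons_of_adj hb]
        exact ⟨ih.1, congrArg _ ih.2⟩
      · simp only [extract_cons_of_adj ha, extract_cons_of_not_adj hbne hb, and_self]
    · obtain ⟨y, rfl⟩ | hb | ⟨hbne, hb⟩ := letter_cases Γ β a
      · exact absurd h ha
      · simp only [extract_cons_of_not_adj hane ha, extract_cons_of_adj hb, and_self]
      · simp only [extract_cons_of_not_adj hane ha, extract_cons_of_not_adj hbne hb, and_self]

/-! ### Reduced words -/

/-- A word is reduced if its letters are nontrivial and no two letters from the same vertex can be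
made neighbours by shuffling. -/
def Reduced (Γ : SimpleGraph V) {M : V → Type*} [∀ α, Monoid (M α)] : List (Σ α, M α) → Prop
  | [] => True
  | a :: l => a.2 ≠ 1 ∧ (extract Γ a.1 l).1 = 1 ∧ Reduced Γ l

theorem Shuffle.reduced {l l' : List (Σ α, M α)} (h : Shuffle Γ l l') (hl : Reduced Γ l) :
    Reduced Γ l' := by
  induction h with
  | refl l => exact hl
  | swap a b l h =>
    obtain ⟨ha, ha', hb, hb', hl⟩ := hl
    rw [extract_cons_of_adj h] at ha'
    exact ⟨hb, by rwa [extract_cons_of_adj h.symm], ha, ha', hl⟩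
  | cons a h ih => exact ⟨hl.1, (h.extract a.1).1 ▸ hl.2.1, ih hl.2.2⟩
  | trans _ _ ih₁ ih₂ => exact ih₂ (ih₁ hl)

theorem Reduced.extract_eq {l : List (Σ α, M α)} (hl : Reduced Γ l) {α : V}
    (h : (extract Γ α l).1 = 1) : extract Γ α l = (1, l) := by
  induction l with
  | nil => rfl
  | cons a l ih =>
    obtain ⟨x, rfl⟩ | ha | ⟨hne, ha⟩ := letter_cases Γ α a
    · rw [extract_cons_self] at h
      exact absurd h hl.1
    · rw [extract_cons_of_adj ha] at h ⊢
      rw [ih hl.2.2 h]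
    · exact extract_cons_of_not_adj hne ha l

theorem Reduced.extract_snd {l : List (Σ α, M α)} (hl : Reduced Γ l) (α : V) :
    Reduced Γ (extract Γ α l).2 ∧ extract Γ α (extract Γ α l).2 = (1, (extract Γ α l).2) := by
  suffices H : Reduced Γ (extract Γ α l).2 ∧ (extract Γ α (extract Γ α l).2).1 = 1 from
    ⟨H.1, H.1.extract_eq H.2⟩
  induction l with
  | nil => exact ⟨trivial, rfl⟩
  | cons a l ih =>
    obtain ⟨x, rfl⟩ | ha | ⟨hne, ha⟩ := letter_cases Γ α a
    · rw [extract_cons_self]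
      exact ⟨hl.2.2, hl.2.1⟩
    · obtain ⟨ih₁, ih₂⟩ := ih hl.2.2
      rw [extract_cons_of_adj ha]
      refine ⟨⟨hl.1, ?_, ih₁⟩, ?_⟩
      · rw [(extract_extract ha l).1]
        exact hl.2.1
      · rwa [extract_cons_of_adj ha]
    · simp only [extract_cons_of_not_adj hne ha]
      exact ⟨hl, trivial⟩

open Classical in
/-- Prepends a letter from the vertex `α`, unless it is trivial. -/
noncomputable def consNeOne (α : V) (x : M α) (l : List (Σ α, M α)) : List (Σ α, M α) :=
  if x = 1 then l else ⟨α, x⟩ :: l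

theorem consNeOne_one (α : V) (l : List (Σ α, M α)) : consNeOne α 1 l = l := if_pos rfl

theorem consNeOne_of_ne {α : V} {x : M α} (hx : x ≠ 1) (l : List (Σ α, M α)) :
    consNeOne α x l = ⟨α, x⟩ :: l := if_neg hx

theorem Shuffle.consNeOne {l l' : List (Σ α, M α)} (h : Shuffle Γ l l') (α : V) (x : M α) :
    Shuffle Γ (consNeOne α x l) (consNeOne α x l') := by
  by_cases hx : x = 1
  · simpa only [hx, consNeOne_one] using h
  · simpa only [consNeOne_of_ne hx] using Shuffle.cons _ h

theorem shuffle_consNeOne_swap {α β : V} (h : Γ.Adj α β) (x : M α) (y : M β)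
    (l : List (Σ α, M α)) :
    Shuffle Γ (consNeOne α x (consNeOne β y l)) (consNeOne β y (consNeOne α x l)) := by
  by_cases hx : x = 1
  · simpa only [hx, consNeOne_one] using Shuffle.refl _
  · by_cases hy : y = 1
    · simpa only [hy, consNeOne_one] using Shuffle.refl _
    · simpa only [consNeOne_of_ne hx, consNeOne_of_ne hy] using Shuffle.swap _ _ _ h

theorem eval_consNeOne (α : V) (x : M α) (l : List (Σ α, M α)) :
    eval Γ (consNeOne α x l) = eval Γ l * of Γ α x := by
  by_cases hx : x = 1
  · rw [hx, consNeOne_one, map_one, mul_one]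
  · rw [consNeOne_of_ne hx, eval]

theorem extract_consNeOne_of_adj {α β : V} (h : Γ.Adj β α) (x : M α) (l : List (Σ α, M α)) :
    extract Γ β (consNeOne α x l) =
      ((extract Γ β l).1, consNeOne α x (extract Γ β l).2) := by
  by_cases hx : x = 1
  · simp only [hx, consNeOne_one]
  · simp only [consNeOne_of_ne hx, extract_cons_of_adj (a := ⟨α, x⟩) h]

theorem Reduced.shuffle_consNeOne_extract {l : List (Σ α, M α)} (hl : Reduced Γ l) (α : V) :
    Shuffle Γ (consNeOne α (extract Γ α l).1 (extract Γ α l).2) l := by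
  by_cases hx : (extract Γ α l).1 = 1
  · rw [hl.extract_eq hx, consNeOne_one]
    exact .refl l
  · rw [consNeOne_of_ne hx]
    induction l with
    | nil => exact absurd rfl hx
    | cons a l ih =>
      obtain ⟨x, rfl⟩ | ha | ⟨hne, ha⟩ := letter_cases Γ α a
      · rw [extract_cons_self]
        exact .refl _
      · rw [extract_cons_of_adj ha] at hx ⊢
        exact .trans (.swap _ _ _ ha) (.cons _ (ih hl.2.2 hx))
      · rw [extract_cons_of_not_adj hne ha] at hx
        exact absurd rfl hx

/-! ### The right action of the letters on reduced words -/

/-- The reduced word obtained from a reduced word by right multiplication with a letter. -/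
noncomputable def push (Γ : SimpleGraph V) {M : V → Type*} [∀ α, Monoid (M α)] (α : V) (m : M α)
    (l : List (Σ α, M α)) : List (Σ α, M α) :=
  consNeOne α ((extract Γ α l).1 * m) (extract Γ α l).2

theorem eval_push (α : V) (m : M α) (l : List (Σ α, M α)) :
    eval Γ (push Γ α m l) = eval Γ l * of Γ α m := by
  rw [push, eval_consNeOne, map_mul, ← mul_assoc, eval_extract]

theorem Shuffle.push {l l' : List (Σ α, M α)} (h : Shuffle Γ l l') (α : V) (m : M α) :
    Shuffle Γ (push Γ α m l) (push Γ α m l') := by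
  rw [GraphProduct.push, GraphProduct.push, (h.extract α).1]
  exact (h.extract α).2.consNeOne α _

theorem Reduced.push {l : List (Σ α, M α)} (hl : Reduced Γ l) (α : V) (m : M α) :
    Reduced Γ (push Γ α m l) := by
  obtain ⟨h₁, h₂⟩ := hl.extract_snd α
  by_cases hx : (extract Γ α l).1 * m = 1
  · rwa [GraphProduct.push, hx, consNeOne_one]
  · rw [GraphProduct.push, consNeOne_of_ne hx]
    exact ⟨hx, congrArg Prod.fst h₂, h₁⟩

theorem Reduced.extract_push {l : List (Σ α, M α)} (hl : Reduced Γ l) (α : V) (m : M α) :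
    extract Γ α (GraphProduct.push Γ α m l) = ((extract Γ α l).1 * m, (extract Γ α l).2) := by
  by_cases hx : (extract Γ α l).1 * m = 1
  · rw [GraphProduct.push, hx, consNeOne_one, (hl.extract_snd α).2]
  · rw [GraphProduct.push, consNeOne_of_ne hx, extract_cons_self]

theorem extract_push_of_adj {α β : V} (h : Γ.Adj β α) (m : M α) (l : List (Σ α, M α)) :
    extract Γ β (push Γ α m l) = ((extract Γ β l).1, push Γ α m (extract Γ β l).2) := by
  rw [push, push, extract_consNeOne_of_adj h, (extract_extract h.symm l).1,
    (extract_extract h.symm l).2, (extract_extract h l).1]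

theorem extract_push_of_not_adj {α β : V} (hne : α ≠ β) (h : ¬ Γ.Adj β α) {m : M α}
    {l : List (Σ α, M α)} (hm : (extract Γ α l).1 * m ≠ 1) :
    (extract Γ β (push Γ α m l)).1 = 1 := by
  rw [push, consNeOne_of_ne hm, extract_cons_of_not_adj (a := ⟨α, _⟩) hne h]

theorem Reduced.push_mul {l : List (Σ α, M α)} (hl : Reduced Γ l) (α : V) (m n : M α) :
    GraphProduct.push Γ α (m * n) l = GraphProduct.push Γ α n (GraphProduct.push Γ α m l) := by
  rw [GraphProduct.push, GraphProduct.push.eq_def Γ α n, hl.extract_push, mul_assoc]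

theorem shuffle_push_swap {α β : V} (h : Γ.Adj α β) (m : M α) (n : M β) (l : List (Σ α, M α)) :
    Shuffle Γ (push Γ α m (push Γ β n l)) (push Γ β n (push Γ α m l)) := by
  rw [push, push.eq_def Γ β n (push Γ α m l), extract_push_of_adj h, extract_push_of_adj h.symm,
    push, push, (extract_extract h l).1, (extract_extract h l).2, (extract_extract h.symm l).1]
  exact shuffle_consNeOne_swap h _ _ _

/-! ### Normal forms -/

/-- Reduced words up to shuffling. -/
def reducedSetoid (Γ : SimpleGraph V) (M : V → Type*) [∀ α, Monoid (M α)] :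
    Setoid {l : List (Σ α, M α) // Reduced Γ l} where
  r l l' := Shuffle Γ l.1 l'.1
  iseqv := ⟨fun l => .refl l.1, .symm, .trans⟩

/-- The set of normal forms of elements of the graph product: reduced words up to shuffling. -/
abbrev NormalForm (Γ : SimpleGraph V) (M : V → Type*) [∀ α, Monoid (M α)] : Type _ :=
  Quotient (reducedSetoid Γ M)

/-- Right multiplication of a normal form by a letter. -/
noncomputable def NormalForm.push {α : V} (m : M α) : NormalForm Γ M → NormalForm Γ M :=
  Quotient.map (fun l => ⟨GraphProduct.push Γ α m l.1, l.2.push α m⟩)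
    fun _ _ (h : Shuffle Γ _ _) => h.push α m

/-- The element of the graph product represented by a normal form. -/
def NormalForm.eval : NormalForm Γ M → GraphProduct Γ M :=
  Quotient.lift (fun l => GraphProduct.eval Γ l.1) fun _ _ h => Shuffle.eval_eq h

/-- The final syllable from the vertex `γ`. -/
noncomputable def NormalForm.fin (γ : V) : NormalForm Γ M → M γ :=
  Quotient.lift (fun l => (extract Γ γ l.1).1) fun _ _ (h : Shuffle Γ _ _) => (h.extract γ).1

/-- The element which remains after removal of the final syllable from the vertex `γ`. -/
noncomputable def NormalForm.rem (γ : V) : NormalForm Γ M → GraphProduct Γ M :=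
  Quotient.lift (fun l => GraphProduct.eval Γ (extract Γ γ l.1).2)
    fun _ _ (h : Shuffle Γ _ _) => (h.extract γ).2.eval_eq

/-- The right action of the graph product on normal forms. Elements of `Function.End` compose from
the right to the left, hence the opposite monoid. -/
noncomputable def act (Γ : SimpleGraph V) (M : V → Type*) [∀ α, Monoid (M α)] :
    GraphProduct Γ M →* (Function.End (NormalForm Γ M))ᵐᵒᵖ :=
  lift
    (fun α =>
      { toFun := fun m => .op (NormalForm.push m)
        map_one' := by
          refine congrArg MulOpposite.op (funext fun p => ?_)
          induction p using Quotient.inductionOn with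
          | h l =>
            refine Quotient.sound ?_
            change Shuffle Γ (GraphProduct.push Γ α 1 l.1) l.1
            rw [GraphProduct.push, mul_one]
            exact l.2.shuffle_consNeOne_extract α
        map_mul' := fun m n => by
          refine congrArg MulOpposite.op (funext fun p => ?_)
          induction p using Quotient.inductionOn with
          | h l => exact congrArg (Quotient.mk _) (Subtype.ext (l.2.push_mul α m n)) })
    (by
      intro α β h m n
      refine congrArg MulOpposite.op (funext fun p => ?_)
      induction p using Quotient.inductionOn with
      | h l => exact Quotient.sound (shuffle_push_swap h.symm n m l.1))

/-- The normal form of an element of the graph product. -/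
noncomputable def normalForm (g : GraphProduct Γ M) : NormalForm Γ M :=
  (act Γ M g).unop (Quotient.mk _ ⟨[], trivial⟩)

theorem normalForm_mul_of (g : GraphProduct Γ M) {α : V} (m : M α) :
    normalForm (g * of Γ α m) = (normalForm g).push m := by
  rw [normalForm, map_mul, act, lift_of]
  rfl

theorem eval_normalForm (g : GraphProduct Γ M) : (normalForm g).eval = g := by
  obtain ⟨l, rfl⟩ := exists_eval_eq g
  induction l with
  | nil =>
    rw [eval, normalForm, map_one]
    rfl
  | cons a l ih =>
    rw [eval, normalForm_mul_of]
    conv_rhs => rw [← ih]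
    induction normalForm (eval Γ l) using Quotient.inductionOn with
    | h l => exact eval_push a.1 a.2 l.1

/-- The syllable from the vertex `γ` that can be moved to the end of `g`; it is `1` if there is no
such syllable. -/
noncomputable def fin (γ : V) (g : GraphProduct Γ M) : M γ := (normalForm g).fin γ

/-- What remains of `g` after removal of the final syllable `fin γ g`. -/
noncomputable def rem (γ : V) (g : GraphProduct Γ M) : GraphProduct Γ M := (normalForm g).rem γ

theorem rem_mul_fin (γ : V) (g : GraphProduct Γ M) : rem γ g * of Γ γ (fin γ g) = g := by
  conv_rhs => rw [← eval_normalForm g]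
  rw [rem, fin]
  induction normalForm g using Quotient.inductionOn with
  | h l => exact eval_extract γ l.1

theorem fin_mul_of (g : GraphProduct Γ M) {γ : V} (m : M γ) :
    fin γ (g * of Γ γ m) = fin γ g * m := by
  rw [fin, fin, normalForm_mul_of]
  induction normalForm g using Quotient.inductionOn with
  | h l => exact congrArg Prod.fst (l.2.extract_push γ m)

theorem rem_mul_of (g : GraphProduct Γ M) {γ : V} (m : M γ) :
    rem γ (g * of Γ γ m) = rem γ g := by
  rw [rem, rem, normalForm_mul_of]
  induction normalForm g using Quotient.inductionOn with
  | h l => exact congrArg (fun p => eval Γ p.2) (l.2.extract_push γ m)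

theorem fin_mul_of_adj (g : GraphProduct Γ M) {γ β : V} (h : Γ.Adj γ β) (m : M β) :
    fin γ (g * of Γ β m) = fin γ g := by
  rw [fin, fin, normalForm_mul_of]
  induction normalForm g using Quotient.inductionOn with
  | h l => exact (congrArg Prod.fst (extract_push_of_adj h m l.1) :)

theorem rem_mul_of_adj (g : GraphProduct Γ M) {γ β : V} (h : Γ.Adj γ β) (m : M β) :
    rem γ (g * of Γ β m) = rem γ g * of Γ β m := by
  rw [rem, rem, normalForm_mul_of]
  induction normalForm g using Quotient.inductionOn with
  | h l =>
    exact (congrArg (fun p => eval Γ p.2) (extract_push_of_adj h m l.1)).trans (eval_push _ _ _)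

theorem fin_mul_of_not_adj {g : GraphProduct Γ M} {γ β : V} (hne : β ≠ γ) (h : ¬ Γ.Adj γ β)
    {m : M β} (hm : fin β g * m ≠ 1) : fin γ (g * of Γ β m) = 1 := by
  rw [fin] at hm ⊢
  rw [normalForm_mul_of]
  induction hg : normalForm g using Quotient.inductionOn with
  | h l =>
    rw [hg] at hm
    exact extract_push_of_not_adj hne h hm

theorem fin_rem_mul_eval {γ : V} {w : List (Σ α, M α)} (h : ∀ a ∈ w, Γ.Adj γ a.1)
    (g : GraphProduct Γ M) :
    fin γ (g * eval Γ w) = fin γ g ∧ rem γ (g * eval Γ w) = rem γ g * eval Γ w := by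
  induction w with
  | nil => simp only [eval, mul_one, and_self]
  | cons a w ih =>
    rw [List.forall_mem_cons] at h
    rw [eval, ← mul_assoc, ← mul_assoc, fin_mul_of_adj _ h.1, rem_mul_of_adj _ h.1, (ih h.2).1,
      (ih h.2).2]
    exact ⟨rfl, rfl⟩

/-! ### Annihilators of rigid words -/

/-- A letter from the vertex `γ` following the word `w` cannot be moved past all of `w`, nor next to
another letter from `γ`. -/
def Blocked (Γ : SimpleGraph V) {M : V → Type*} (γ : V) : List (Σ α, M α) → Prop
  | [] => False
  | a :: w => a.1 ≠ γ ∧ (Γ.Adj γ a.1 → Blocked Γ γ w)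

/-- A word is rigid if each of its letters is either nontrivial and blocked by the letters before
it, or not left invertible and preceded only by letters from vertices adjacent to its own. -/
def Rigid (Γ : SimpleGraph V) {M : V → Type*} [∀ α, Monoid (M α)] : List (Σ α, M α) → Prop
  | [] => True
  | a :: w => Rigid Γ w ∧
      ((Blocked Γ a.1 w ∧ a.2 ≠ 1) ∨ ((∀ b ∈ w, Γ.Adj a.1 b.1) ∧ ∀ u, u * a.2 ≠ 1))

theorem Rigid.fin_mul_eval {w : List (Σ α, M α)} (hw : Rigid Γ w) {γ : V} (h : Blocked Γ γ w)
    (s : GraphProduct Γ M) : fin γ (s * eval Γ w) = 1 := by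
  induction w generalizing γ with
  | nil => exact h.elim
  | cons a w ih =>
    rw [eval, ← mul_assoc]
    by_cases hadj : Γ.Adj γ a.1
    · rw [fin_mul_of_adj _ hadj]
      exact ih hw.1 (h.2 hadj)
    · refine fin_mul_of_not_adj h.1 hadj ?_
      obtain ⟨hb, ha⟩ | ⟨hb, ha⟩ := hw.2
      · rwa [ih hw.1 hb, one_mul]
      · exact ha _

/-- The generators are the annihilating pairs of the initial letters of `w`. They commute with
all vertex monoids commuting with `w`, which carries the induction. -/
theorem Rigid.exists_generators (hM : ∀ α, FinitelyLeftEquated (M α)) {w : List (Σ α, M α)}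
    (hw : Rigid Γ w) :
    ∃ X : Set (GraphProduct Γ M × GraphProduct Γ M), X.Finite ∧
      (∀ p ∈ X, p.1 * eval Γ w = p.2 * eval Γ w) ∧
      (∀ γ, (∀ a ∈ w, Γ.Adj γ a.1) → ∀ m : M γ, ∀ p ∈ X,
        Commute (of Γ γ m) p.1 ∧ Commute (of Γ γ m) p.2) ∧
      ∀ s t, s * eval Γ w = t * eval Γ w → LeftCongruence.GenRel X s t := by
  induction w with
  | nil =>
    refine ⟨∅, Set.finite_empty, by simp, by simp, fun s t h => ?_⟩
    rw [eval, mul_one, mul_one] at h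
    exact h ▸ .refl s
  | cons a w ih =>
    obtain ⟨γ, c⟩ := a
    obtain ⟨X, hX, hX₁, hX₂, hX₃⟩ := ih hw.1
    simp only [List.forall_mem_cons, eval, ← mul_assoc]
    obtain ⟨hb, -⟩ | ⟨hadj, -⟩ := hw.2
    · -- The letter `c` is never absorbed, so it can be cancelled.
      refine ⟨X, hX, fun p hp => by rw [hX₁ p hp], fun δ hδ => hX₂ δ hδ.2, fun s t h => ?_⟩
      apply hX₃
      have h' := congrArg (rem γ) h
      rw [rem_mul_of, rem_mul_of] at h'
      rw [← rem_mul_fin γ (s * eval Γ w), ← rem_mul_fin γ (t * eval Γ w), h',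
        hw.1.fin_mul_eval hb, hw.1.fin_mul_eval hb]
    · obtain ⟨Y, hY, hY₁, hY₂⟩ :=
        LeftCongruence.isFinitelyGenerated_leftAnnihilator_iff.1 (hM γ c)
      refine ⟨X ∪ Prod.map (of Γ γ) (of Γ γ) '' Y, hX.union (hY.image _), ?_, ?_, ?_⟩
      · rintro p (hp | ⟨q, hq, rfl⟩)
        · rw [hX₁ p hp]
        · have hr : ∀ x : M γ, of Γ γ x * eval Γ w * of Γ γ c = eval Γ w * of Γ γ (x * c) :=
            fun x => by rw [(commute_of_eval hadj x).eq, mul_assoc, map_mul]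
          simp only [Prod.map_fst, Prod.map_snd, hr, hY₁ q hq]
      · rintro δ ⟨hδ, hδw⟩ m p (hp | ⟨q, hq, rfl⟩)
        · exact hX₂ δ hδw m p hp
        · exact ⟨commute_of hδ m q.1, commute_of hδ m q.2⟩
      · intro s t h
        have hfin := congrArg (fin γ) h
        rw [fin_mul_of, fin_mul_of, (fin_rem_mul_eval hadj s).1, (fin_rem_mul_eval hadj t).1]
          at hfin
        have hrem := congrArg (rem γ) h
        rw [rem_mul_of, rem_mul_of, (fin_rem_mul_eval hadj s).2, (fin_rem_mul_eval hadj t).2]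
          at hrem
        have h₁ := (hX₃ _ _ hrem).mul_right_of_commute (hX₂ γ hadj (fin γ s))
        have h₂ := (((hY₂ _ _ hfin).map (of Γ γ)
          (Y := Prod.map (of Γ γ) (of Γ γ) '' Y) fun x y hxy => ⟨(x, y), hxy, rfl⟩).mul_left
            (rem γ t))
        rw [rem_mul_fin] at h₁ h₂
        exact (h₁.mono Set.subset_union_left).trans (h₂.mono Set.subset_union_right)

theorem isFinitelyGenerated_leftAnnihilator_of (hM : ∀ α, FinitelyLeftEquated (M α)) {γ : V}
    (c : M γ) : (LeftCongruence.leftAnnihilator (of Γ γ c)).IsFinitelyGenerated := by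
  obtain ⟨Y, hY, hY₁, hY₂⟩ := LeftCongruence.isFinitelyGenerated_leftAnnihilator_iff.1 (hM γ c)
  refine LeftCongruence.isFinitelyGenerated_leftAnnihilator_iff.2
    ⟨Prod.map (of Γ γ) (of Γ γ) '' Y, hY.image _, ?_, fun s t h => ?_⟩
  · rintro _ ⟨q, hq, rfl⟩
    simp only [Prod.map_fst, Prod.map_snd, ← map_mul, hY₁ q hq]
  · have hfin := congrArg (fin γ) h
    have hrem := congrArg (rem γ) h
    rw [fin_mul_of, fin_mul_of] at hfin
    rw [rem_mul_of, rem_mul_of] at hrem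
    have h₂ := (((hY₂ _ _ hfin).map (of Γ γ)
      (Y := Prod.map (of Γ γ) (of Γ γ) '' Y) fun x y hxy => ⟨(x, y), hxy, rfl⟩).mul_left
        (rem γ s))
    rwa [rem_mul_fin, hrem, rem_mul_fin] at h₂

/-! ### Reduction to rigid words -/

theorem blocked_or_adj_or_exists_append {M : V → Type*} (Γ : SimpleGraph V) (γ : V)
    (w : List (Σ α, M α)) :
    Blocked Γ γ w ∨ (∀ a ∈ w, Γ.Adj γ a.1) ∨
      ∃ (p q : List (Σ α, M α)) (x : M γ), w = p ++ ⟨γ, x⟩ :: q ∧ ∀ a ∈ p, Γ.Adj γ a.1 := by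
  induction w with
  | nil => exact .inr (.inl (by simp))
  | cons a w ih =>
    obtain ⟨x, rfl⟩ | ha | ⟨hne, ha⟩ := letter_cases Γ γ a
    · exact .inr (.inr ⟨[], w, x, rfl, by simp⟩)
    · obtain h | h | ⟨p, q, x, rfl, h⟩ := ih
      · exact .inl ⟨ha.ne', fun _ => h⟩
      · exact .inr (.inl (List.forall_mem_cons.2 ⟨ha, h⟩))
      · exact .inr (.inr ⟨a :: p, q, x, rfl, List.forall_mem_cons.2 ⟨ha, h⟩⟩)
    · exact .inl ⟨hne, fun h => absurd h ha⟩

/-- A word which is not rigid can be shortened, possibly at the cost of splitting off a left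
invertible letter on the left. The letter `c = 1` covers the case of a mere shortening. -/
theorem exists_shorter_of_not_rigid {w : List (Σ α, M α)} (hw : ¬ Rigid Γ w) :
    ∃ w' : List (Σ α, M α), w'.length < w.length ∧
      ∃ (γ : V) (u c : M γ), u * c = 1 ∧ eval Γ w = of Γ γ c * eval Γ w' := by
  induction w with
  | nil => exact absurd trivial hw
  | cons a w ih =>
    by_cases hw' : Rigid Γ w
    · obtain ⟨γ, c⟩ := a
      obtain h | h | ⟨p, q, x, rfl, h⟩ := blocked_or_adj_or_exists_append Γ γ w
      · have hc : c = 1 := by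
          by_contra hc
          exact hw ⟨hw', .inl ⟨h, hc⟩⟩
        exact ⟨w, by simp, γ, 1, 1, mul_one 1, by simp [eval, hc]⟩
      · have hc : ∃ u, u * c = 1 := by
          by_contra! hc
          exact hw ⟨hw', .inr ⟨h, hc⟩⟩
        obtain ⟨u, hu⟩ := hc
        exact ⟨w, by simp, γ, u, c, hu, by rw [eval, (commute_of_eval h c).eq]⟩
      · refine ⟨p ++ ⟨γ, x * c⟩ :: q, by simp, γ, 1, 1, mul_one 1, ?_⟩
        simp only [eval, eval_append, map_one, one_mul, map_mul, mul_assoc,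
          (commute_of_eval h c).eq]
    · obtain ⟨w', hlt, γ, u, c, huc, he⟩ := ih hw'
      exact ⟨a :: w', by simpa using hlt, γ, u, c, huc, by rw [eval, eval, he, mul_assoc]⟩

theorem isFinitelyGenerated_leftAnnihilator_eval (hM : ∀ α, FinitelyLeftEquated (M α))
    (w : List (Σ α, M α)) :
    (LeftCongruence.leftAnnihilator (eval Γ w)).IsFinitelyGenerated := by
  induction hn : w.length using Nat.strong_induction_on generalizing w with
  | _ n ih =>
    subst hn
    by_cases hw : Rigid Γ w
    · obtain ⟨X, hX, hX₁, -, hX₃⟩ := hw.exists_generators hM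
      exact LeftCongruence.isFinitelyGenerated_leftAnnihilator_iff.2 ⟨X, hX, hX₁, hX₃⟩
    · obtain ⟨w', hlt, γ, u, c, huc, he⟩ := exists_shorter_of_not_rigid hw
      rw [he]
      exact LeftCongruence.isFinitelyGenerated_mul (u := of Γ γ u)
        (by rw [← map_mul, huc, map_one]) (isFinitelyGenerated_leftAnnihilator_of hM c)
        (ih _ hlt w' rfl)

end GraphProduct

theorem theorem6p1 {V : Type*} (Γ : SimpleGraph V) (M : V → Type*) [∀ α, Monoid (M α)] :
    FinitelyLeftEquated (GraphProduct Γ M) ↔ ∀ α : V, FinitelyLeftEquated (M α) := by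
  refine ⟨fun h α => h.of_retract (GraphProduct.of Γ α) (GraphProduct.proj Γ M α)
    (GraphProduct.proj_of α), fun hM a => ?_⟩
  obtain ⟨w, rfl⟩ := GraphProduct.exists_eval_eq a
  exact GraphProduct.isFinitelyGenerated_leftAnnihilator_eval hM w
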